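/- Let $K$ be a number field with algebraic closure $\bar K$, and let $$P(z,w)=p_n(z)w^n+\cdots+p_0(z)\in K[z,w]$$ be a polynomial of $w$-degree $n$ (so $p_n\neq 0$) that is $w$-separable, that is, not divisible by the square of a polynomial in $K[z,w]$ of positive $w$-degree. Assume that $p_n(0)\ne 0$. Let $e$ be a positive integer (not assumed minimal) and let $f(z)\in \bar K((z^{1/e}))$ be a series satisfying $P(z,f(z))=0$. Let $L$ be the field generated over $K$ by all coefficients of $f$. Then: 1. $f$ has no negative part, that is, $f(z)=\sum_{k=0}^\infty a_kz^{k/e}\in\bar K[[z^{1/e}]]$. 2. The field $L$ is a finite extension of $K$. Moreover, putting $\Lambda_0=K$ and $\Lambda_k=K(a_0,\dots,a_{k-1})$ for $k\ge 1$, one has $\Lambda_k=L$ for all sufficiently large $k$. In particular, the degrees $\lambda_k=[L:\Lambda_k]$ are finite, and all but finitely many of them are equal to $1$. 3. $P'_w(z,f(z))\neq 0$, where $P'_w=\partial P/\partial w$, and $$\sum_{k=0}^\infty \frac ke\,(\lambda_k-\lambda_{k+1})\le \operatorname{ord}_z P'_w\bigl(z,f(z)\bigr),$$ where $\operatorname{ord}_z$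 of a non-zero series in $z^{1/e}$ is the smallest exponent of $z$ (an element of $\frac1e\mathbb Z$) occurring in it with a non-zero coefficient. -/

import Mathlib

open Polynomial

noncomputable section

/-- A polynomial `P(z, w)` over `F`, viewed as a polynomial in the outer variable `w` with
coefficients in `F[z]`, is `w`-separable if it is not divisible by the square of a polynomial of
positive `w`-degree. -/
def IsWSeparable {F : Type*} [Field F] (P : F[X][X]) : Prop :=
  ∀ Q : F[X][X], 0 < Q.natDegree → ¬ Q ^ 2 ∣ P

/-- The series `f` belongs to `E((z^{1/e}))`: all its exponents lie in `(1/e)ℤ`.  Inside the field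
`HahnSeries ℚ E` of series with well-ordered support in `ℚ` this cuts out exactly the Laurent
series in `z^{1/e}`, where `z` is the monomial `HahnSeries.single 1 1`. -/
def IsPuiseuxSeries {E : Type*} [Field E] (e : ℕ) (f : HahnSeries ℚ E) : Prop :=
  ∀ q : ℚ, f.coeff q ≠ 0 → ∃ j : ℤ, q = (j : ℚ) / (e : ℚ)

/-- The value `P(z, g)` of a polynomial `P(z, w)` over `F` at a series `g` over an extension `E`
of `F`. -/
def evalAtSeries {F E : Type*} [Field F] [Field E] [Algebra F E] (P : F[X][X])
    (g : HahnSeries ℚ E) : HahnSeries ℚ E :=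
  P.eval₂ (eval₂RingHom (HahnSeries.C.comp (algebraMap F E)) (HahnSeries.single (1 : ℚ) (1 : E))) g

/-- The field generated over `F` by all coefficients of the series `f`. -/
def coeffField (F : Type*) {E : Type*} [Field F] [Field E] [Algebra F E] (f : HahnSeries ℚ E) :
    IntermediateField F E :=
  IntermediateField.adjoin F (Set.range f.coeff)

/-- The field `F(a_0, …, a_{k-1})`, where `a_i` is the coefficient of `z^{i/e}` in `f`. -/
def initialCoeffField (F : Type*) {E : Type*} [Field F] [Field E] [Algebra F E] (e : ℕ)
    (f : HahnSeries ℚ E) (k : ℕ) : IntermediateField F E :=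
  IntermediateField.adjoin F {a : E | ∃ i : ℕ, i < k ∧ a = f.coeff ((i : ℚ) / (e : ℚ))}

/-- The degree of the field generated by all coefficients of `f` over the field generated by the
first `k` of them. -/
def coeffDegree (F : Type*) {E : Type*} [Field F] [Field E] [Algebra F E] (e : ℕ)
    (f : HahnSeries ℚ E) (k : ℕ) : ℕ :=
  IntermediateField.relfinrank (initialCoeffField F e f k) (coeffField F f)

/-- The field of the first `k` coefficients lies in the field of all
coefficients, so that `coeffDegree` is a genuine relative degree. -/
theorem initialCoeffField_le_coeffField (F : Type*) {E : Type*} [Field F] [Field E] [Algebra F E]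
    (e : ℕ) (f : HahnSeries ℚ E) (k : ℕ) : initialCoeffField F e f k ≤ coeffField F f := by
  refine IntermediateField.adjoin.mono F _ _ ?_
  rintro a ⟨i, -, rfl⟩
  exact ⟨_, rfl⟩

end

/-!
Write `n` for the `w`-degree of `P`, `p_n` for its leading coefficient, `L` for the field
`coeffField` of all coefficients of `f`, `Λ_k` for `initialCoeffField` and `λ_k = [L : Λ_k]` for
`coeffDegree`.

Let `O` be the valuation ring of Hahn series over `E`, the algebraic closure, that have no negative
exponents. Since `p_n(0) ≠ 0`, the leading coefficient of `P` is a unit of `O`, so every root of `P`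
is integral over `O` and therefore lies in `O`
(`mem_nonnegSeries_of_evalAtSeries_eq_zero`).

By Gauss's lemma `P` is squarefree over the field of rational functions in `z`, hence separable in
characteristic zero, and its derivative does not vanish at `f`
(`evalAtSeries_derivative_ne_zero`).

Endomorphisms of `E` over the ground field act on series through the coefficients and permute the
roots of `P`. Distinct embeddings of a field generated by coefficients of `f` give distinct
conjugates of `f`, so such fields have degree at most `n`; this bounds the chain of fields
`Λ_k` and makes it stabilize (`exists_initialCoeffField_eq_coeffField`).

Finally, `λ_k` is the number of embeddings of `L` that fix `a_0, …, a_{k-1}`, so `λ_k - λ_{k+1}`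
counts the embeddings `σ` for which `a_k` is the first coefficient moved, and for these
`f - f^σ` has order `k / e`. Thus the sum in question is at most the order of the product
of all `f - f^σ` with `σ` nontrivial. Because `O[w]` contains the factorization of `P` by the monic
polynomial `∏ (w - f^σ)`, this product divides `P'_w(z, f)` in `O`
(`Polynomial.prod_sub_dvd_eval_derivative`), which gives the inequality
(`tsum_coeffDegree_le_order`).
-/

/-! ### Separability and Gauss's lemma -/

/-- Gauss's lemma turns a square factor over `F(z)` into the square of a primitive factor over
`F[z]` of the same `w`-degree. -/
theorem squarefree_map_fractionRing_of_isWSeparable {F : Type*} [Field F] {P : F[X][X]}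
    (hP : IsWSeparable P) :
    Squarefree (P.map (algebraMap F[X] (FractionRing F[X]))) := by
  let _ : NormalizedGCDMonoid F[X] := Classical.arbitrary _
  intro x hx
  have hP0 : P ≠ 0 := by
    rintro rfl
    exact hP X (by simp) (dvd_zero _)
  have hx0 : x ≠ 0 := by
    rintro rfl
    rw [zero_mul, zero_dvd_iff, Polynomial.map_eq_zero_iff (IsFractionRing.injective _ _)] at hx
    exact hP0 hx
  obtain ⟨b, hb, hbx⟩ := IsLocalization.integerNormalization_spec (nonZeroDivisors F[X]) x
  set N := IsLocalization.integerNormalization (nonZeroDivisors F[X]) x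
  set φ := algebraMap F[X] (FractionRing F[X])
  have hφ : Function.Injective φ := IsFractionRing.injective _ _
  have hb0 : φ b ≠ 0 := (map_ne_zero_iff φ hφ).2 (nonZeroDivisors.ne_zero hb)
  have unitC : ∀ c : FractionRing F[X], c ≠ 0 → IsUnit (C c) := fun c hc =>
    isUnit_C.2 (isUnit_iff_ne_zero.2 hc)
  have hNx : N.map φ = C (φ b) * x := by
    rw [hbx, Algebra.smul_def]; rfl
  have hN0 : N ≠ 0 := by
    intro h
    rw [h, Polynomial.map_zero] at hNx
    exact mul_ne_zero (unitC _ hb0).ne_zero hx0 hNx.symm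
  have hprim : ∀ Q : F[X][X], Q ≠ 0 → Associated (Q.primPart.map φ) (Q.map φ) := by
    intro Q hQ
    conv_rhs => rw [Q.eq_C_content_mul_primPart, Polynomial.map_mul, map_C]
    exact (associated_unit_mul_left _ _ (unitC _ ((map_ne_zero_iff φ hφ).2
      (content_eq_zero_iff.not.2 hQ)))).symm
  have hassoc : Associated (N.primPart.map φ) x :=
    (hprim N hN0).trans (hNx ▸ associated_unit_mul_left _ _ (unitC _ hb0))
  have hdvd : N.primPart ^ 2 ∣ P.primPart := by
    refine IsPrimitive.dvd_of_fraction_map_dvd_fraction_map (K := FractionRing F[X]) ?_ ?_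
    · rw [sq]; exact N.isPrimitive_primPart.mul N.isPrimitive_primPart
    · rw [sq, Polynomial.map_mul]
      exact ((hassoc.mul_mul hassoc).dvd.trans hx).trans (hprim P hP0).symm.dvd
  have hdeg : N.primPart.natDegree = 0 := by
    by_contra h
    exact hP _ (Nat.pos_of_ne_zero h) (hdvd.trans P.primPart_dvd)
  refine hassoc.isUnit ?_
  rw [eq_C_of_natDegree_eq_zero hdeg, map_C]
  refine unitC _ ((map_ne_zero_iff φ hφ).2 fun h => N.primPart_ne_zero ?_)
  rw [eq_C_of_natDegree_eq_zero hdeg, h, C_0]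

theorem eval₂_derivative_ne_zero_of_separable_map_fractionRing {A L : Type*} [CommRing A]
    [IsDomain A] [Field L] {φ : A →+* L} (hφ : Function.Injective φ) {P : A[X]}
    (hP : (P.map (algebraMap A (FractionRing A))).Separable) {f : L} (hroot : P.eval₂ φ f = 0) :
    (derivative P).eval₂ φ f ≠ 0 := by
  have hψ : ∀ Q : A[X], (Q.map (algebraMap A (FractionRing A))).eval₂
      (IsFractionRing.lift hφ) f = Q.eval₂ φ f := by
    intro Q
    have : (IsFractionRing.lift hφ).comp (algebraMap A (FractionRing A)) = φ :=
      RingHom.ext fun p => IsFractionRing.lift_algebraMap hφ p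
    rw [eval₂_map, this]
  have h := hP.eval₂_derivative_ne_zero _ ((hψ P).trans hroot)
  rwa [derivative_map, hψ] at h

/-! ### Polynomials in `z` as Hahn series -/

noncomputable section

/-- The embedding of `F[z]` into the Hahn series over `E`, sending `z` to the monomial of
exponent `1`. -/
def polynomialToSeries (F E : Type*) [Field F] [Field E] [Algebra F E] :
    F[X] →+* HahnSeries ℚ E :=
  eval₂RingHom (HahnSeries.C.comp (algebraMap F E)) (HahnSeries.single (1 : ℚ) (1 : E))

variable {F E : Type*} [Field F] [Field E] [Algebra F E]

theorem polynomialToSeries_eq_ofPowerSeries (p : F[X]) :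
    polynomialToSeries F E p =
      HahnSeries.ofPowerSeries ℚ E ((p.map (algebraMap F E) : E[X]) : PowerSeries E) := by
  induction p using Polynomial.induction_on' with
  | add p q hp hq => simp [hp, hq]
  | monomial n a =>
    rw [← C_mul_X_pow_eq_monomial]
    simp [polynomialToSeries, HahnSeries.ofPowerSeries_C, HahnSeries.ofPowerSeries_X]

theorem polynomialToSeries_injective : Function.Injective (polynomialToSeries F E) := by
  intro p q h
  rw [polynomialToSeries_eq_ofPowerSeries, polynomialToSeries_eq_ofPowerSeries] at h
  exact map_injective _ (algebraMap F E).injective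
    (Polynomial.coe_injective E (HahnSeries.ofPowerSeries_injective h))

theorem coeff_zero_polynomialToSeries (p : F[X]) :
    (polynomialToSeries F E p).coeff 0 = algebraMap F E (p.eval 0) := by
  have := HahnSeries.ofPowerSeries_apply_coeff (Γ := ℚ)
    ((p.map (algebraMap F E) : E[X]) : PowerSeries E) 0
  rw [polynomialToSeries_eq_ofPowerSeries]
  simpa [coeff_zero_eq_eval_zero] using this

theorem evalAtSeries_derivative_ne_zero [CharZero F] {P : F[X][X]} (hP : IsWSeparable P)
    {f : HahnSeries ℚ E} (hroot : evalAtSeries P f = 0) :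
    evalAtSeries (derivative P) f ≠ 0 :=
  eval₂_derivative_ne_zero_of_separable_map_fractionRing polynomialToSeries_injective
    (PerfectField.separable_iff_squarefree.2 (squarefree_map_fractionRing_of_isWSeparable hP)) hroot

/-! ### Series without negative exponents -/

variable (E) in
/-- The valuation ring of Hahn series all of whose exponents are non-negative. -/
def nonnegSeries : ValuationSubring (HahnSeries ℚ E) :=
  (AddValuation.toValuation (HahnSeries.addVal ℚ E)).valuationSubring

theorem mem_nonnegSeries {x : HahnSeries ℚ E} : x ∈ nonnegSeries E ↔ 0 ≤ x.orderTop := by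
  rw [← HahnSeries.addVal_apply]
  exact Iff.rfl

theorem mem_nonnegSeries_iff_coeff {x : HahnSeries ℚ E} :
    x ∈ nonnegSeries E ↔ ∀ q < 0, x.coeff q = 0 := by
  rw [mem_nonnegSeries]
  refine ⟨fun h q hq => HahnSeries.coeff_eq_zero_of_lt_orderTop
    ((WithTop.coe_lt_coe.2 hq).trans_le h), fun h => ?_⟩
  by_cases hx : x = 0
  · simp [hx]
  · rw [← HahnSeries.order_eq_orderTop_of_ne_zero hx]
    refine WithTop.coe_le_coe.2 (le_of_not_gt fun hlt => ?_)
    exact hx (HahnSeries.coeff_order_eq_zero.1 (h _ hlt))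

theorem polynomialToSeries_mem (p : F[X]) : polynomialToSeries F E p ∈ nonnegSeries E := by
  rw [mem_nonnegSeries_iff_coeff]
  intro q hq
  rw [polynomialToSeries_eq_ofPowerSeries, HahnSeries.ofPowerSeries_apply]
  refine HahnSeries.embDomain_of_notMem_range ?_
  rintro ⟨n, rfl⟩
  exact absurd hq (not_lt.2 (Nat.cast_nonneg (α := ℚ) n))

variable (F E) in
/-- `polynomialToSeries` with values in the valuation ring of series without negative part. -/
def polynomialToNonneg : F[X] →+* nonnegSeries E :=
  (polynomialToSeries F E).codRestrict (nonnegSeries E) polynomialToSeries_mem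

theorem coe_eval_polynomialToNonneg (P : F[X][X]) (g : nonnegSeries E) :
    (((P.map (polynomialToNonneg F E)).eval g : nonnegSeries E) : HahnSeries ℚ E) =
      evalAtSeries P g := by
  rw [eval_map, ← ValuationSubring.subtype_apply, hom_eval₂]
  rfl

/-- A polynomial with nonzero constant term has order zero, and so does its inverse. -/
theorem isUnit_polynomialToNonneg {p : F[X]} (hp : p.eval 0 ≠ 0) :
    IsUnit (polynomialToNonneg F E p) := by
  have hc : (polynomialToSeries F E p).coeff 0 ≠ 0 := by
    rw [coeff_zero_polynomialToSeries]
    exact (_root_.map_ne_zero _).2 hp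
  have h0 : (polynomialToSeries F E p).orderTop = 0 :=
    le_antisymm (HahnSeries.orderTop_le_of_coeff_ne_zero hc)
      (mem_nonnegSeries.1 (polynomialToSeries_mem p))
  have hne : polynomialToSeries F E p ≠ 0 := by rintro h; simp [h] at hc
  have hinv : (polynomialToSeries F E p)⁻¹ ∈ nonnegSeries E := by
    have h1 : ((polynomialToSeries F E p) * (polynomialToSeries F E p)⁻¹).orderTop = 0 := by
      rw [mul_inv_cancel₀ hne, HahnSeries.orderTop_one]
    rw [← HahnSeries.addVal_apply, AddValuation.map_mul, HahnSeries.addVal_apply, h0, zero_add,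
      HahnSeries.addVal_apply] at h1
    exact mem_nonnegSeries.2 h1.ge
  exact IsUnit.of_mul_eq_one ⟨_, hinv⟩ (Subtype.ext (mul_inv_cancel₀ hne))

/-- Dividing `P` by its leading coefficient, a unit of the valuation ring, shows that `f` is integral
over this integrally closed ring. -/
theorem mem_nonnegSeries_of_evalAtSeries_eq_zero {P : F[X][X]} (hint : P.leadingCoeff.eval 0 ≠ 0)
    {f : HahnSeries ℚ E} (hroot : evalAtSeries P f = 0) : f ∈ nonnegSeries E := by
  have hu := isUnit_polynomialToNonneg (E := E) hint
  obtain ⟨u, hu'⟩ := hu.exists_left_inv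
  have hlc : (P.map (polynomialToNonneg F E)).leadingCoeff =
      polynomialToNonneg F E P.leadingCoeff := leadingCoeff_map_of_leadingCoeff_ne_zero _ hu.ne_zero
  have hf : IsIntegral (nonnegSeries E) f := by
    refine ⟨C u * P.map (polynomialToNonneg F E),
      monic_C_mul_of_mul_leadingCoeff_eq_one (by rw [hlc, hu']), ?_⟩
    rw [eval₂_mul, eval₂_map]
    exact (congrArg _ hroot).trans (mul_zero _)
  obtain ⟨y, rfl⟩ := IsIntegrallyClosed.isIntegral_iff.1 hf
  exact y.2

end

/-! ### Derivatives at a root and the other roots -/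

/-- If `a` and the `g i` are distinct roots of `p`, then `p` is divisible by
`(X - a) * ∏ (X - g i)`; differentiating and evaluating at `a` leaves the product of the `a - g i`
times the value of the cofactor. -/
theorem Polynomial.prod_sub_dvd_eval_derivative {R ι : Type*} [CommRing R] [IsDomain R] {p : R[X]}
    (hp : p ≠ 0) {a : R} (ha : p.IsRoot a) (s : Finset ι) (g : ι → R)
    (hg : ∀ i ∈ s, p.IsRoot (g i)) (hinj : Set.InjOn g s) (hne : ∀ i ∈ s, g i ≠ a) :
    ∏ i ∈ s, (a - g i) ∣ (derivative p).eval a := by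
  classical
  have hle : (insert a (s.image g)).val ≤ p.roots := by
    rw [Multiset.le_iff_subset (Finset.nodup _)]
    intro b hb
    rw [Finset.mem_val, Finset.mem_insert, Finset.mem_image] at hb
    rw [mem_roots hp]
    rcases hb with rfl | ⟨i, hi, rfl⟩
    exacts [ha, hg i hi]
  have hprod : (∏ b ∈ insert a (s.image g), (X - C b)) ∣ p :=
    (Multiset.prod_X_sub_C_dvd_iff_le_roots hp _).2 hle
  rw [Finset.prod_insert (by simpa using hne), Finset.prod_image hinj] at hprod
  obtain ⟨r, rfl⟩ := hprod
  refine ⟨r.eval a, ?_⟩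
  simp [derivative_mul, eval_prod]

/-! ### Conjugate series -/

noncomputable section

variable {F E : Type*} [Field F] [Field E] [Algebra F E]

/-- The action of an endomorphism of `E` over `F` on Hahn series, coefficient by coefficient. -/
def conjSeries (σ : E →ₐ[F] E) : HahnSeries ℚ E →+* HahnSeries ℚ E where
  toFun x := x.map σ
  map_zero' := by ext; simp
  map_one' := by ext q; by_cases hq : q = 0 <;> simp [HahnSeries.coeff_one, hq]
  map_add' x y := by ext; simp
  map_mul' x y := HahnSeries.map_mul (σ : E →ₙ+* E)

@[simp]
theorem coeff_conjSeries (σ : E →ₐ[F] E) (x : HahnSeries ℚ E) (q : ℚ) :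
    (conjSeries σ x).coeff q = σ (x.coeff q) := rfl

theorem evalAtSeries_conjSeries (σ : E →ₐ[F] E) (P : F[X][X]) (f : HahnSeries ℚ E) :
    evalAtSeries P (conjSeries σ f) = conjSeries σ (evalAtSeries P f) := by
  have h : (conjSeries σ).comp (polynomialToSeries F E) = polynomialToSeries F E := by
    refine Polynomial.ringHom_ext (fun a => ?_) ?_
    · ext q
      by_cases hq : q = 0 <;>
      simp [polynomialToSeries, HahnSeries.C_apply, hq]
    · ext q
      by_cases hq : q = 1 <;> simp [polynomialToSeries, hq]
  change eval₂ (polynomialToSeries F E) _ P = conjSeries σ (eval₂ (polynomialToSeries F E) _ P)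
  rw [hom_eval₂, h]

end

/-! ### Embeddings and relative degrees -/

section

variable {F E : Type*} [Field F] [Field E] [Algebra F E]

theorem AlgHom.eqOn_intermediateField_adjoin {S : Set E} {σ τ : E →ₐ[F] E} (h : Set.EqOn σ τ S) :
    Set.EqOn σ τ (IntermediateField.adjoin F S) := by
  intro x hx
  exact DFunLike.congr_fun (IntermediateField.adjoin_algHom_ext F
    (φ₁ := σ.comp (IntermediateField.adjoin F S).val)
    (φ₂ := τ.comp (IntermediateField.adjoin F S).val)
    (fun y hy => h hy)) ⟨x, hx⟩

/-- Fixing such extensions lets every embedding of the coefficient field act on Hahn series over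
`E`. -/
theorem exists_algHom_extension [IsAlgClosed E] [Algebra.IsAlgebraic F E]
    {A : IntermediateField F E} (σ : A →ₐ[F] E) : ∃ τ : E →ₐ[F] E, ∀ x : A, τ x = σ x := by
  obtain ⟨τ, rfl⟩ := IsAlgClosed.surjective_domRestrict_of_isAlgebraic (E := E) σ
  exact ⟨τ, fun x => rfl⟩

/-- In characteristic zero the degree of `B` over `A` is the number of those embeddings of `B` over
the ground field that fix `A`. -/
theorem IntermediateField.relfinrank_eq_card_algHom [CharZero F] [IsAlgClosed E]
    {A B : IntermediateField F E} (h : A ≤ B) [FiniteDimensional F B] :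
    relfinrank A B =
      Nat.card {σ : B →ₐ[F] E // ∀ x (hx : x ∈ A), σ ⟨x, h hx⟩ = x} := by
  have hfin : FiniteDimensional A (extendScalars h) := by
    have : FiniteDimensional F (extendScalars h) := ‹FiniteDimensional F B›
    exact FiniteDimensional.right F A _
  rw [relfinrank_eq_finrank_of_le h, ← AlgHom.natCard_of_splits A (extendScalars h) E
    fun _ => IsAlgClosed.splits _]
  refine Nat.card_congr
    { toFun := fun σ => ⟨(σ.restrictScalars F : extendScalars h →ₐ[F] E), fun x hx =>
        σ.commutes ⟨x, hx⟩⟩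
      invFun := fun σ => { (σ.1 : B →+* E) with commutes' := fun x => σ.2 x x.2 }
      left_inv := fun σ => rfl
      right_inv := fun σ => rfl }

theorem exists_forall_ge_eq_of_finrank_le {A : ℕ → IntermediateField F E} (hA : Monotone A)
    [∀ k, FiniteDimensional F (A k)] {n : ℕ} (hn : ∀ k, Module.finrank F (A k) ≤ n) :
    ∃ k₀, ∀ k, k₀ ≤ k → A k = A k₀ := by
  have hbdd : BddAbove (Set.range fun k => Module.finrank F (A k)) :=
    ⟨n, by rintro _ ⟨k, rfl⟩; exact hn k⟩
  -- The chain is constant from an index on at which the degree is maximal.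
  obtain ⟨k₀, hk₀⟩ := Nat.sSup_mem (Set.range_nonempty _) hbdd
  refine ⟨k₀, fun k hk => (IntermediateField.eq_of_le_of_finrank_le (hA hk) ?_).symm⟩
  exact (le_csSup hbdd ⟨k, rfl⟩).trans_eq hk₀.symm

end

/-! ### Bounded degree of the coefficient field -/

section

variable {F E : Type*} [Field F] [Field E] [Algebra F E]

theorem eqOn_coeffField_of_conjSeries_eq {f : HahnSeries ℚ E} {σ τ : E →ₐ[F] E}
    (h : conjSeries σ f = conjSeries τ f) : Set.EqOn σ τ (coeffField F f) := by
  refine AlgHom.eqOn_intermediateField_adjoin ?_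
  rintro _ ⟨q, rfl⟩
  exact congrArg (fun g : HahnSeries ℚ E => g.coeff q) h

/-- The embeddings of a subfield of the coefficient field, extended to `E`, give distinct conjugates
of `f`, all of them roots of `P`; hence there are at most `deg_w P` of them. -/
theorem finrank_le_natDegree_of_le_coeffField [CharZero F] [IsAlgClosed E]
    [Algebra.IsAlgebraic F E] {P : F[X][X]} (hP : P ≠ 0) {f : HahnSeries ℚ E}
    (hroot : evalAtSeries P f = 0) {A : IntermediateField F E} [FiniteDimensional F A]
    (hA : A ≤ coeffField F f) : Module.finrank F A ≤ P.natDegree := by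
  classical
  choose τ hτ using fun σ : A →ₐ[F] E => exists_algHom_extension σ
  have hP' : P.map (polynomialToSeries F E) ≠ 0 :=
    (Polynomial.map_ne_zero_iff polynomialToSeries_injective).2 hP
  have hmem : ∀ σ, conjSeries (τ σ) f ∈ (P.map (polynomialToSeries F E)).roots.toFinset := by
    intro σ
    rw [Multiset.mem_toFinset, mem_roots hP', IsRoot, eval_map]
    exact (evalAtSeries_conjSeries _ P f).trans (by rw [hroot, map_zero])
  have hinj : Function.Injective fun σ => conjSeries (τ σ) f := by
    intro σ σ' h
    ext x
    rw [← hτ, ← hτ]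
    exact eqOn_coeffField_of_conjSeries_eq h (hA x.2)
  calc Module.finrank F A = Fintype.card (A →ₐ[F] E) := (AlgHom.card F A E).symm
    _ ≤ (P.map (polynomialToSeries F E)).roots.toFinset.card :=
        Finset.card_le_card_of_injOn _ (fun σ _ => hmem σ) hinj.injOn
    _ ≤ (P.map (polynomialToSeries F E)).roots.card := Multiset.toFinset_card_le _
    _ ≤ (P.map (polynomialToSeries F E)).natDegree := card_roots' _
    _ ≤ P.natDegree := natDegree_map_le

theorem initialCoeffField_mono (e : ℕ) (f : HahnSeries ℚ E) :
    Monotone (initialCoeffField F e f) := by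
  intro k l hkl
  refine IntermediateField.adjoin.mono F _ _ ?_
  rintro _ ⟨i, hi, rfl⟩
  exact ⟨i, hi.trans_le hkl, rfl⟩

theorem finiteDimensional_initialCoeffField [Algebra.IsAlgebraic F E] (e : ℕ)
    (f : HahnSeries ℚ E) (k : ℕ) : FiniteDimensional F (initialCoeffField F e f k) := by
  have hfin : {a : E | ∃ i : ℕ, i < k ∧ a = f.coeff ((i : ℚ) / (e : ℚ))}.Finite := by
    refine ((Set.finite_Iio k).image fun i : ℕ => f.coeff ((i : ℚ) / (e : ℚ))).subset ?_
    rintro _ ⟨i, hi, rfl⟩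
    exact ⟨i, hi, rfl⟩
  have := hfin.to_subtype
  exact IntermediateField.finiteDimensional_adjoin fun x _ => Algebra.IsIntegral.isIntegral x

theorem exists_nat_eq_div_of_coeff_ne_zero {e : ℕ} (he : 0 < e) {f : HahnSeries ℚ E}
    (hf : IsPuiseuxSeries e f) (hf0 : f ∈ nonnegSeries E) {q : ℚ} (hq : f.coeff q ≠ 0) :
    ∃ i : ℕ, q = (i : ℚ) / (e : ℚ) := by
  obtain ⟨j, rfl⟩ := hf q hq
  have hj : 0 ≤ j := by
    by_contra! hj
    exact hq (mem_nonnegSeries_iff_coeff.1 hf0 _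
      (div_neg_of_neg_of_pos (by exact_mod_cast hj) (by exact_mod_cast he)))
  lift j to ℕ using hj
  exact ⟨j, by simp⟩

/-- The fields generated by the first `k` coefficients form a chain of bounded degree, so the chain
stabilizes, and its last member contains all coefficients. -/
theorem exists_initialCoeffField_eq_coeffField [CharZero F] [IsAlgClosed E]
    [Algebra.IsAlgebraic F E] {P : F[X][X]} (hP : P ≠ 0) {e : ℕ} (he : 0 < e)
    {f : HahnSeries ℚ E} (hf : IsPuiseuxSeries e f) (hf0 : f ∈ nonnegSeries E)
    (hroot : evalAtSeries P f = 0) :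
    ∃ k₀, ∀ k, k₀ ≤ k → initialCoeffField F e f k = coeffField F f := by
  have := finiteDimensional_initialCoeffField (F := F) e f
  obtain ⟨k₀, hk₀⟩ := exists_forall_ge_eq_of_finrank_le (initialCoeffField_mono (F := F) e f)
    fun k => finrank_le_natDegree_of_le_coeffField hP hroot
      (initialCoeffField_le_coeffField F e f k)
  have hle : coeffField F f ≤ initialCoeffField F e f k₀ := by
    refine IntermediateField.adjoin_le_iff.2 ?_
    rintro _ ⟨q, rfl⟩
    by_cases hq : f.coeff q = 0
    · rw [hq]; exact zero_mem _
    · obtain ⟨i, rfl⟩ := exists_nat_eq_div_of_coeff_ne_zero he hf hf0 hq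
      have : f.coeff ((i : ℚ) / (e : ℚ)) ∈ initialCoeffField F e f (max k₀ (i + 1)) :=
        IntermediateField.subset_adjoin F _ ⟨i, by omega, rfl⟩
      rwa [hk₀ _ (le_max_left _ _)] at this
  refine ⟨k₀, fun k hk => le_antisymm (initialCoeffField_le_coeffField F e f k) ?_⟩
  rwa [hk₀ k hk]

end

/-! ### Counting embeddings by the first coefficient they move -/

/-- Abel summation by counting: `M i k` says that `i` is moved at stage `k`, and the difference of the
two cardinalities counts those `i` that are moved for the first time at stage `k`. -/
theorem hasSum_mul_card_sub_card {ι : Type*} [Fintype ι] (M : ι → ℕ → Prop)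
    [DecidablePred fun i => ∃ k, M i k] (w : ℕ → ℚ) :
    HasSum (fun k => w k * ((Nat.card {i // ∀ j < k, ¬ M i j} : ℚ) -
        (Nat.card {i // ∀ j < k + 1, ¬ M i j} : ℚ)))
      (∑ i with ∃ k, M i k, w (sInf {k | M i k})) := by
  classical
  have hcard : ∀ k, (Nat.card {i // ∀ j < k, ¬ M i j} : ℚ) =
      ∑ i, if ∀ j < k, ¬ M i j then (1 : ℚ) else 0 := by
    intro k
    rw [Finset.sum_boole, Nat.card_eq_fintype_card, Fintype.card_subtype]
  -- Each `i` contributes only at the stage at which it is first moved.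
  have hterm : ∀ k, w k * ((Nat.card {i // ∀ j < k, ¬ M i j} : ℚ) -
      (Nat.card {i // ∀ j < k + 1, ¬ M i j} : ℚ)) =
      ∑ i with ∃ k, M i k, if k = sInf {k | M i k} then w (sInf {k | M i k}) else 0 := by
    intro k
    rw [hcard, hcard, ← Finset.sum_sub_distrib, Finset.mul_sum, Finset.sum_filter]
    refine Finset.sum_congr rfl fun i _ => ?_
    by_cases hi : ∃ k, M i k
    · have hmem : M i (sInf {k | M i k}) := Nat.sInf_mem hi
      have hiff : ∀ l, (∀ j < l, ¬ M i j) ↔ l ≤ sInf {k | M i k} := fun l =>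
        ⟨fun h => le_of_not_gt fun hlt => h _ hlt hmem,
          fun h j hj hM => absurd (Nat.sInf_le (s := {k | M i k}) hM) (not_le.2 (hj.trans_le h))⟩
      simp only [hiff, hi, if_true]
      rcases lt_trichotomy k (sInf {k | M i k}) with h | h | h
      · simp [h.le, Nat.succ_le_of_lt h, h.ne]
      · simp [← h]
      · simp [not_le.2 h, not_le.2 (h.trans k.lt_succ_self), h.ne']
    · have hM : ∀ k, ¬ M i k := not_exists.1 hi
      simp [hM]
  simp_rw [hterm]
  exact hasSum_sum fun i _ => hasSum_ite_eq _ _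

section

variable {F E : Type*} [Field F] [Field E] [Algebra F E]

/-- The degree `[L : F(a_0, …, a_{k-1})]` counts the embeddings of the coefficient field `L` that
move none of the first `k` coefficients; `τ` extends these embeddings to `E`. -/
theorem coeffDegree_eq_card [CharZero F] [IsAlgClosed E] (e : ℕ) (f : HahnSeries ℚ E)
    [FiniteDimensional F (coeffField F f)] {τ : (coeffField F f →ₐ[F] E) → (E →ₐ[F] E)}
    (hτ : ∀ σ (x : coeffField F f), τ σ x = σ x) (k : ℕ) :
    coeffDegree F e f k = Nat.card {σ : coeffField F f →ₐ[F] E //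
      ∀ j < k, ¬ τ σ (f.coeff ((j : ℚ) / (e : ℚ))) ≠ f.coeff ((j : ℚ) / (e : ℚ))} := by
  rw [coeffDegree, IntermediateField.relfinrank_eq_card_algHom
    (initialCoeffField_le_coeffField F e f k)]
  refine Nat.card_congr (Equiv.subtypeEquivRight fun σ => ⟨fun h j hj => ?_, fun h x hx => ?_⟩)
  · have hmem : f.coeff ((j : ℚ) / (e : ℚ)) ∈ initialCoeffField F e f k :=
      IntermediateField.subset_adjoin F _ ⟨j, hj, rfl⟩
    exact not_not.2 ((hτ σ ⟨_, initialCoeffField_le_coeffField F e f k hmem⟩).trans (h _ hmem))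
  · rw [← hτ]
    refine AlgHom.eqOn_intermediateField_adjoin (τ := AlgHom.id F E) ?_ hx
    rintro _ ⟨j, hj, rfl⟩
    exact not_not.1 (h j hj)

/-! ### The order of the derivative -/

theorem HahnSeries.order_finset_prod {ι : Type*} (s : Finset ι) {y : ι → HahnSeries ℚ E}
    (hy : ∀ i ∈ s, y i ≠ 0) : (∏ i ∈ s, y i).order = ∑ i ∈ s, (y i).order := by
  classical
  induction s using Finset.induction_on with
  | empty => simp
  | insert a s ha ih =>
    rw [Finset.prod_insert ha, Finset.sum_insert ha, HahnSeries.order_mul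
      (hy a (Finset.mem_insert_self a s))
      (Finset.prod_ne_zero_iff.2 fun i hi => hy i (Finset.mem_insert_of_mem hi)),
      ih fun i hi => hy i (Finset.mem_insert_of_mem hi)]

/-- The series `f` and its conjugate agree below the first coefficient that is moved. -/
theorem sInf_moved_le_order_sub_conjSeries {e : ℕ} (he : 0 < e) {f : HahnSeries ℚ E}
    (hf : IsPuiseuxSeries e f) (hf0 : f ∈ nonnegSeries E) {σ : E →ₐ[F] E}
    (hσ : f - conjSeries σ f ≠ 0) :
    ((sInf {k : ℕ | σ (f.coeff ((k : ℚ) / (e : ℚ))) ≠ f.coeff ((k : ℚ) / (e : ℚ))} : ℕ) : ℚ) /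
      (e : ℚ) ≤ (f - conjSeries σ f).order := by
  have hne := HahnSeries.coeff_order_eq_zero.not.2 hσ
  set q := (f - conjSeries σ f).order
  rw [HahnSeries.coeff_sub, coeff_conjSeries, sub_eq_zero] at hne
  have hq : f.coeff q ≠ 0 := fun h => hne (by rw [h, map_zero])
  obtain ⟨i, hi⟩ := exists_nat_eq_div_of_coeff_ne_zero he hf hf0 hq
  rw [hi] at hne ⊢
  gcongr
  exact Nat.sInf_le (Ne.symm hne)

/-- The left-hand side is the sum, over the nontrivial embeddings `σ` of the coefficient field, of
the exponent of the first term of `f` moved by `σ`. The product of the differences between `f` and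
its conjugates divides the value of the derivative in the ring of series without negative part. -/
theorem tsum_coeffDegree_le_order [CharZero F] [IsAlgClosed E] [Algebra.IsAlgebraic F E]
    {P : F[X][X]} (hint : P.leadingCoeff.eval 0 ≠ 0) {e : ℕ} (he : 0 < e)
    {f : HahnSeries ℚ E} (hf : IsPuiseuxSeries e f) (hroot : evalAtSeries P f = 0)
    (hder : evalAtSeries (derivative P) f ≠ 0) [FiniteDimensional F (coeffField F f)] :
    (∑' k : ℕ, ((k : ℚ) / (e : ℚ)) *
        ((coeffDegree F e f k : ℚ) - (coeffDegree F e f (k + 1) : ℚ)))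
      ≤ (evalAtSeries (derivative P) f).order := by
  classical
  have hf0 := mem_nonnegSeries_of_evalAtSeries_eq_zero hint hroot
  choose τ hτ using fun σ : coeffField F f →ₐ[F] E => exists_algHom_extension σ
  have hroot' : ∀ σ, evalAtSeries P (conjSeries (τ σ) f) = 0 := fun σ => by
    rw [evalAtSeries_conjSeries, hroot, map_zero]
  let M : (coeffField F f →ₐ[F] E) → ℕ → Prop := fun σ k =>
    τ σ (f.coeff ((k : ℚ) / (e : ℚ))) ≠ f.coeff ((k : ℚ) / (e : ℚ))
  have hne : ∀ σ, (∃ k, M σ k) → f - conjSeries (τ σ) f ≠ 0 := by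
    rintro σ ⟨k, hk⟩ h
    exact hk (congrArg (fun g : HahnSeries ℚ E => g.coeff ((k : ℚ) / (e : ℚ)))
      (sub_eq_zero.1 h)).symm
  -- The divisibility below is applied over the valuation ring, so that the cofactor `r` has
  -- non-negative order.
  let f₀ : nonnegSeries E := ⟨f, hf0⟩
  let g : (coeffField F f →ₐ[F] E) → nonnegSeries E := fun σ =>
    ⟨conjSeries (τ σ) f, mem_nonnegSeries_of_evalAtSeries_eq_zero hint (hroot' σ)⟩
  have hP₀ : P.map (polynomialToNonneg F E) ≠ 0 := by
    rw [← leadingCoeff_ne_zero, leadingCoeff_map_of_leadingCoeff_ne_zero _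
      (isUnit_polynomialToNonneg hint).ne_zero]
    exact (isUnit_polynomialToNonneg hint).ne_zero
  have hdvd := Polynomial.prod_sub_dvd_eval_derivative hP₀ (a := f₀)
    (Subtype.ext ((coe_eval_polynomialToNonneg P f₀).trans hroot))
    {σ | ∃ k, M σ k} g
    (fun σ _ => Subtype.ext ((coe_eval_polynomialToNonneg P (g σ)).trans (hroot' σ)))
    (fun σ _ σ' _ h => by
      ext x
      rw [← hτ, ← hτ]
      exact eqOn_coeffField_of_conjSeries_eq (congrArg Subtype.val h) x.2)
    (fun σ hσ h => hne σ (by simpa using hσ) (sub_eq_zero.2 (congrArg Subtype.val h).symm))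
  obtain ⟨r, hr⟩ := hdvd
  have hval : evalAtSeries (derivative P) f =
      (∏ σ with ∃ k, M σ k, (f - conjSeries (τ σ) f)) * (r : HahnSeries ℚ E) := by
    rw [← coe_eval_polynomialToNonneg (derivative P) f₀, ← derivative_map, hr,
      ← ValuationSubring.subtype_apply, map_mul, map_prod]
    rfl
  rw [hval] at hder
  have hr0 : (0 : ℚ) ≤ (r : HahnSeries ℚ E).order := by
    have := mem_nonnegSeries.1 r.2
    rw [← HahnSeries.order_eq_orderTop_of_ne_zero (right_ne_zero_of_mul hder)] at this
    exact WithTop.coe_le_coe.1 this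
  have hdeg : ∀ k, coeffDegree F e f k =
      Nat.card {σ : coeffField F f →ₐ[F] E // ∀ j < k, ¬ M σ j} := coeffDegree_eq_card e f hτ
  simp_rw [hdeg]
  rw [(hasSum_mul_card_sub_card M fun k => (k : ℚ) / (e : ℚ)).tsum_eq, hval,
    HahnSeries.order_mul (left_ne_zero_of_mul hder) (right_ne_zero_of_mul hder),
    HahnSeries.order_finset_prod _ fun σ hσ => hne σ (by simpa using hσ)]
  refine le_add_of_le_of_nonneg (Finset.sum_le_sum fun σ hσ => ?_) hr0
  exact sInf_moved_le_order_sub_conjSeries he hf hf0 (hne σ (by simpa using hσ))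

end

theorem mainTheorem12 (K : Type*) [Field K] [NumberField K]
    (P : K[X][X]) (hP : IsWSeparable P)
    (hint : P.leadingCoeff.eval 0 ≠ 0)
    (e : ℕ) (he : 0 < e)
    (f : HahnSeries ℚ (AlgebraicClosure K)) (hf : IsPuiseuxSeries e f)
    (hroot : evalAtSeries P f = 0) :
    (∀ q : ℚ, q < 0 → f.coeff q = 0) ∧
    FiniteDimensional K (coeffField K f) ∧
    (∃ k₀ : ℕ, ∀ k : ℕ, k₀ ≤ k → initialCoeffField K e f k = coeffField K f) ∧
    evalAtSeries (derivative P) f ≠ 0 ∧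
    (∑' k : ℕ, ((k : ℚ) / (e : ℚ)) *
        ((coeffDegree K e f k : ℚ) - (coeffDegree K e f (k + 1) : ℚ)))
      ≤ (evalAtSeries (derivative P) f).order := by
  have hP0 : P ≠ 0 := by rintro rfl; simp at hint
  have hf0 := mem_nonnegSeries_of_evalAtSeries_eq_zero hint hroot
  have hder := evalAtSeries_derivative_ne_zero hP hroot
  obtain ⟨k₀, hk₀⟩ := exists_initialCoeffField_eq_coeffField hP0 he hf hf0 hroot
  have hfin : FiniteDimensional K (coeffField K f) :=
    hk₀ k₀ le_rfl ▸ finiteDimensional_initialCoeffField e f k₀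
  exact ⟨mem_nonnegSeries_iff_coeff.1 hf0, hfin, ⟨k₀, hk₀⟩, hder,
    tsum_coeffDegree_le_order hint he hf hroot hder⟩
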